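/- Let $k\ge 1$ be an integer, let $b_0,b_1,b_2,\lambda_0,\lambda_1>0$ and $\mu\in(0,1)$. Then there is a constant $C>0$, depending only on $k,b_0,b_1,b_2,\lambda_0,\lambda_1,\mu$, such that the following holds for every $T\ge 10$. Let $\ell<r$ be real numbers, let $P\subset(\ell,r)$ be a finite set, let $g:[\ell,r]\to\mathbb R$ be a function, and let $a^-=(a^-_1,\dots,a^-_k)$ and $a^+=(a^+_1,\dots,a^+_k)$ be vectors in $\mathbb R^k$ such that 1. $r-\ell\le b_0T$, $|P|\le b_0T$, and $|g(x)-g(y)|\le b_1T\,|x-y|$ for all $x,y\in[\ell,r]$; 2. $a^-_j-a^-_{j+1}\ge\lambda_0T^{1/2}$ and $a^+_j-a^+_{j+1}\ge\lambda_0T^{1/2}$ for all $1\le j\le k-1$; 3. $a^-_k-g(\ell)\ge\lambda_1T$ and $a^+_k-g(r)\ge\lambda_1T$; 4. $a^-_1-g(\ell)\le b_2T^2$ and $a^+_1-g(r)\le b_2T^2$. Let $\mathcal L=(\mathcal L_1,\dots,\mathcal L_k)$ be, under a probability measure $\mathbb P_{\mathrm{free}}$, independent standard Brownian bridges (diffusion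 parameter one) on $[\ell,r]$ with $\mathcal L_j(\ell)=a^-_j$ and $\mathcal L_j(r)=a^+_j$. Let $W(\mathcal L)=1$ if $\mathcal L_j(p)>g(p)$ for all $p\in P$ and all $1\le j\le k$, let $W(\mathcal L)=0$ otherwise, and let $\mathbb P_{\mathcal L}$ be the law with density $d\mathbb P_{\mathcal L}/d\mathbb P_{\mathrm{free}}=W/\mathbb E_{\mathrm{free}}[W]$. Let $\mathsf H$ be the event that, for every $p\in P$, $$\mathcal L_j(p)-\mathcal L_{j+1}(p)\ge\mu\lambda_0T^{1/2}\quad(1\le j\le k-1)\qquad\text{and}\qquad \mathcal L_k(p)-g(p)\ge\mu\lambda_1T.$$ Then $$\mathbb P_{\mathcal L}(\mathsf H)\ge C^{-1}e^{-CT^{5/2}}.$$ -/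

import Mathlib

open MeasureTheory ProbabilityTheory Set
open scoped ENNReal NNReal

/-- `B` is a standard (diffusion parameter one) Brownian bridge on `[ℓ, r]` from `x` at time `ℓ`
to `y` at time `r`, under the probability measure `ν`: a Gaussian process with almost surely
continuous paths, whose mean is the affine interpolation of the two boundary values and whose
covariance is `(s - ℓ)(r - t)/(r - ℓ)` for `s ≤ t`. At the two end points the variance vanishes, so
that `B ℓ = x` and `B r = y` almost surely. Only the times in `[ℓ, r]` matter. -/
structure IsBrownianBridge {Ω : Type*} [MeasurableSpace Ω] (ν : Measure Ω) (ℓ r x y : ℝ)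
    (B : ℝ → Ω → ℝ) : Prop where
  measurable : ∀ t ∈ Icc ℓ r, Measurable (B t)
  gaussian : IsGaussianProcess (fun t : Icc ℓ r => B t) ν
  mean : ∀ t ∈ Icc ℓ r, ∫ ω, B t ω ∂ν = ((r - t) * x + (t - ℓ) * y) / (r - ℓ)
  covariance : ∀ s ∈ Icc ℓ r, ∀ t ∈ Icc ℓ r, s ≤ t →
    cov[B s, B t; ν] = (s - ℓ) * (r - t) / (r - ℓ)
  continuous_paths : ∀ᵐ ω ∂ν, ContinuousOn (fun t => B t ω) (Icc ℓ r)

/-- `L = (L 0, …, L (k - 1))` is a free Brownian bridge line ensemble on `[ℓ, r]` with entrance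
data `aminus` (at time `ℓ`) and exit data `aplus` (at time `r`): `k` independent standard Brownian
bridges, the `j`-th one going from `aminus j` to `aplus j`. -/
structure IsFreeBridgeEnsemble {Ω : Type*} [MeasurableSpace Ω] (ν : Measure Ω) {k : ℕ}
    (ℓ r : ℝ) (aminus aplus : Fin k → ℝ) (L : Fin k → ℝ → Ω → ℝ) : Prop where
  bridge : ∀ j, IsBrownianBridge ν ℓ r (aminus j) (aplus j) (L j)
  indep : iIndepFun (fun (j : Fin k) (ω : Ω) (t : Icc ℓ r) => L j t ω) ν

/-- The Boltzmann weight: `1` if every curve is strictly above `g` at every pole point of `P`, and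
`0` otherwise. -/
noncomputable def jumpWeight {Ω : Type*} {k : ℕ} (L : Fin k → ℝ → Ω → ℝ) (g : ℝ → ℝ)
    (P : Finset ℝ) : Ω → ℝ≥0∞ :=
  {ω | ∀ p ∈ P, ∀ j, g p < L j p ω}.indicator 1

/-- The measure `ν` conditioned on all curves jumping over `g` at the pole points in `P`, i.e. the
measure with density `W / E[W]` with respect to `ν`, where `W` is the Boltzmann weight. -/
noncomputable def jumpMeasure {Ω : Type*} [MeasurableSpace Ω] (ν : Measure Ω) {k : ℕ}
    (L : Fin k → ℝ → Ω → ℝ) (g : ℝ → ℝ) (P : Finset ℝ) : Measure Ω :=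
  ν.withDensity fun ω => jumpWeight L g P ω / ∫⁻ ω', jumpWeight L g P ω' ∂ν

/-- The event that, at every pole point of `P`, consecutive curves are separated by at least `d₀`
and the lowest curve (the one with index `k - 1`) is at least `d₁` above `g`. -/
def gapEvent {Ω : Type*} {k : ℕ} (L : Fin k → ℝ → Ω → ℝ) (g : ℝ → ℝ) (P : Finset ℝ)
    (d₀ d₁ : ℝ) : Set Ω :=
  {ω | ∀ p ∈ P, ∀ i j : Fin k, (j : ℕ) = i + 1 → d₀ ≤ L i p ω - L j p ω} ∩
  {ω | ∀ p ∈ P, ∀ j : Fin k, (j : ℕ) + 1 = k → d₁ ≤ L j p ω - g p}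

/-!
The conditioning only asks each of the independent curves to pass above `g` on `P`, so the curves
remain independent, and it is enough to compare, curve by curve, the probability of this event with
that of a narrow tube around a suitable path `η j`; the paths are chosen so that the tubes force the
required gaps.

The path `η j` is the least concave path with the boundary values of the curve `j` that lies, on
`P`, above `g` raised by `λ₁ T + (k - 1 - j) λ₀ √T`. It solves an obstacle problem
(`SolvesObstacle`): its slope drops `β` are nonnegative and sit at the points of contact. By the
comparison principle `SolvesObstacle.add_le`, consecutive paths are at least `λ₀ √T` apart, and by
`SolvesObstacle.sum_le` the total slope drop is at most twice the Lipschitz constant `b₁ T` of `g`.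

The Dirichlet energy `E` of `η j` minus its chord may be of order `T³`, but it cancels. On the one
hand, the exponential Chebyshev inequality for the linear form with coefficients `β`
(`IsBrownianBridge.measure_above_le`) bounds the probability of passing above `g` by
`exp (-E / 2 + h ∑ β)`, where `h = O(T)` is the height by which the obstacle was raised. On the
other hand, the Cameron–Martin shift (`measure_cube_shift_ge`) bounds the probability of the tube of
radius `c = δ √T` from below by `exp (-E / 2 - c ∑ β)` times the probability that a centred bridge
stays within `c` of zero on `P`; the latter is at least `q ^ |P|` with `q > 0` independent of `T`,
by the Markov property (`IsBrownianBridge.measure_cube_ge`). The quotient is therefore at least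
`exp (-(c + h) ∑ β) q ^ |P|`, which is `exp (-O(T²))`, and `T² ≤ T ^ (5 / 2)`.
-/

/-! ### The obstacle problem for piecewise linear paths -/

/-- The covariance function of the standard Brownian bridge on `[ℓ, r]`; equally, the Green
function of `-d²/dt²` on `[ℓ, r]` with Dirichlet boundary conditions. -/
noncomputable def bridgeCov (ℓ r s t : ℝ) : ℝ := (min s t - ℓ) * (r - max s t) / (r - ℓ)

/-- The affine function with value `x` at `ℓ` and `y` at `r`. -/
noncomputable def chord (ℓ r x y t : ℝ) : ℝ := ((r - t) * x + (t - ℓ) * y) / (r - ℓ)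

/-- The piecewise linear function which vanishes at `ℓ` and `r` and whose slope drops by `β p` at
each `p ∈ P`. It is concave when `β ≥ 0`. -/
noncomputable def potential (ℓ r : ℝ) (P : Finset ℝ) (β : ℝ → ℝ) (t : ℝ) : ℝ :=
  ∑ p ∈ P, β p * bridgeCov ℓ r p t

section Kernel

variable {ℓ r s t x y : ℝ}

lemma bridgeCov_of_le (h : s ≤ t) : bridgeCov ℓ r s t = (s - ℓ) * (r - t) / (r - ℓ) := by
  rw [bridgeCov, min_eq_left h, max_eq_right h]

lemma bridgeCov_comm : bridgeCov ℓ r s t = bridgeCov ℓ r t s := by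
  rw [bridgeCov, bridgeCov, min_comm, max_comm]

lemma bridgeCov_of_ge (h : t ≤ s) : bridgeCov ℓ r s t = (t - ℓ) * (r - s) / (r - ℓ) := by
  rw [bridgeCov_comm, bridgeCov_of_le h]

lemma bridgeCov_pos (hs : s ∈ Ioo ℓ r) (ht : t ∈ Ioo ℓ r) : 0 < bridgeCov ℓ r s t := by
  have h1 : ℓ < min s t := lt_min hs.1 ht.1
  have h2 : max s t < r := max_lt hs.2 ht.2
  have h3 : ℓ < r := hs.1.trans hs.2
  exact div_pos (mul_pos (by linarith) (by linarith)) (by linarith)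

lemma chord_left (hℓr : ℓ < r) : chord ℓ r x y ℓ = x := by
  have : r - ℓ ≠ 0 := by linarith
  rw [chord]; field_simp; ring

lemma chord_right (hℓr : ℓ < r) : chord ℓ r x y r = y := by
  have : r - ℓ ≠ 0 := by linarith
  rw [chord]; field_simp; ring

lemma potential_left (P : Finset ℝ) (hP : (P : Set ℝ) ⊆ Ioo ℓ r) (β : ℝ → ℝ) :
    potential ℓ r P β ℓ = 0 :=
  Finset.sum_eq_zero fun p hp => by rw [bridgeCov_of_ge (hP hp).1.le]; simp

lemma potential_right (P : Finset ℝ) (hP : (P : Set ℝ) ⊆ Ioo ℓ r) (β : ℝ → ℝ) :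
    potential ℓ r P β r = 0 :=
  Finset.sum_eq_zero fun p hp => by rw [bridgeCov_of_le (hP hp).2.le]; simp

/-- A discrete minimum principle: if the slope of a piecewise linear function can only drop at the
points of `P` where the function is negative, and the function is nonnegative at both ends, then it
is nonnegative on `P`. -/
lemma chord_add_potential_nonneg (hℓr : ℓ < r) (P : Finset ℝ) (hP : (P : Set ℝ) ⊆ Ioo ℓ r)
    (hx : 0 ≤ x) (hy : 0 ≤ y) (α : ℝ → ℝ)
    (hα : ∀ p ∈ P, chord ℓ r x y p + potential ℓ r P α p < 0 → 0 ≤ α p) :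
    ∀ p ∈ P, 0 ≤ chord ℓ r x y p + potential ℓ r P α p := by
  set δ : ℝ → ℝ := fun t => chord ℓ r x y t + potential ℓ r P α t with hδ
  have hδℓ : 0 ≤ δ ℓ := by simp only [hδ]; rw [chord_left hℓr, potential_left P hP]; linarith
  have hδr : 0 ≤ δ r := by simp only [hδ]; rw [chord_right hℓr, potential_right P hP]; linarith
  by_contra! hcon
  obtain ⟨p₀, hp₀, hneg⟩ := hcon
  -- `p` is the leftmost point at which `δ` is minimal on `P`
  obtain ⟨m, hm, hmin⟩ := P.exists_min_image δ ⟨p₀, hp₀⟩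
  obtain ⟨p, hp, hleft⟩ := (P.filter fun q => δ q = δ m).exists_min_image id
    ⟨m, Finset.mem_filter.2 ⟨hm, rfl⟩⟩
  rw [Finset.mem_filter] at hp
  obtain ⟨hpP, hpm⟩ := hp
  have hpneg : δ p < 0 := by rw [hpm]; exact (hmin p₀ hp₀).trans_lt hneg
  obtain ⟨a, ha, hamax⟩ := (insert ℓ (P.filter (· < p))).exists_max_image id ⟨ℓ, by simp⟩
  obtain ⟨b, hb, hbmin⟩ := (insert r (P.filter (p < ·))).exists_min_image id ⟨r, by simp⟩
  simp only [Finset.mem_insert, Finset.mem_filter, id, forall_eq_or_imp] at ha hb hamax hbmin hleft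
  have hap : a < p := by rcases ha with rfl | ha; exacts [(hP hpP).1, ha.2]
  have hpb : p < b := by rcases hb with rfl | hb; exacts [(hP hpP).2, hb.2]
  have hδa : δ p < δ a := by
    rcases ha with rfl | ha
    · linarith
    · refine lt_of_le_of_ne (hpm ▸ hmin a ha.1) fun h => ?_
      have := hleft a ⟨ha.1, h ▸ hpm⟩
      linarith
  have hδb : δ p ≤ δ b := by
    rcases hb with rfl | hb
    · linarith
    · exact hpm ▸ hmin b hb.1
  have hrl : 0 < r - ℓ := by linarith
  have hker : ∀ s ∈ P, α s * ((b - p) * bridgeCov ℓ r s a + (p - a) * bridgeCov ℓ r s b) ≤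
      α s * ((b - a) * bridgeCov ℓ r s p) := by
    intro s hs
    rcases lt_trichotomy s p with h | rfl | h
    · have hsa : s ≤ a := hamax.2 s ⟨hs, h⟩
      rw [bridgeCov_of_le hsa, bridgeCov_of_le h.le, bridgeCov_of_le (h.trans hpb).le]
      apply le_of_eq; field_simp; ring
    · refine mul_le_mul_of_nonneg_left ?_ (hα s hpP hpneg)
      rw [bridgeCov_of_ge hap.le, bridgeCov_of_le le_rfl, bridgeCov_of_le hpb.le,
        mul_div_assoc', mul_div_assoc', mul_div_assoc', ← add_div, div_le_div_iff_of_pos_right hrl]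
      nlinarith [mul_pos (sub_pos.2 hap) (sub_pos.2 hpb)]
    · have hsb : b ≤ s := hbmin.2 s ⟨hs, h⟩
      rw [bridgeCov_of_ge hsb, bridgeCov_of_ge h.le, bridgeCov_of_ge (hap.trans h).le]
      apply le_of_eq; field_simp; ring
  have hsum := Finset.sum_le_sum hker
  have hpot : (b - p) * potential ℓ r P α a + (p - a) * potential ℓ r P α b ≤
      (b - a) * potential ℓ r P α p := by
    simp only [potential, Finset.mul_sum, ← Finset.sum_add_distrib]
    refine le_trans (le_of_eq ?_) (hsum.trans (le_of_eq ?_)) <;>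
      exact Finset.sum_congr rfl fun _ _ => by ring
  have hch : (b - p) * chord ℓ r x y a + (p - a) * chord ℓ r x y b =
      (b - a) * chord ℓ r x y p := by
    simp only [chord]; field_simp; ring
  have hconc : (b - p) * δ a + (p - a) * δ b ≤ (b - a) * δ p := by
    simp only [hδ]; linarith
  nlinarith [mul_pos (sub_pos.2 hpb) (sub_pos.2 hδa), mul_nonneg (sub_pos.2 hap).le
    (sub_nonneg.2 hδb)]

end Kernel

/-- Solvability of the linear complementarity problem for a symmetric matrix with positive entries
that is positive on the nonnegative orthant: the solution is the minimiser of
`½ ⟨β, K β⟩ - ⟨β, c⟩` over `β ≥ 0`, and the conditions are the first order optimality conditions. -/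
lemma exists_complementarity {ι : Type*} [Fintype ι] (K : ι → ι → ℝ) (hK : ∀ i j, 0 < K i j)
    (hsymm : ∀ i j, K i j = K j i) (c : ι → ℝ) :
    ∃ β : ι → ℝ, (∀ i, 0 ≤ β i) ∧ (∀ i, c i ≤ ∑ j, β j * K j i) ∧
      ∀ i, β i * (∑ j, β j * K j i - c i) = 0 := by
  classical
  rcases isEmpty_or_nonempty ι with hι | hι
  · exact ⟨0, fun i => isEmptyElim i, fun i => isEmptyElim i, fun i => isEmptyElim i⟩
  set F : (ι → ℝ) → ℝ := fun β => (∑ i, ∑ j, β i * β j * K i j) / 2 - ∑ i, β i * c i with hF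
  have hFc : Continuous F := by fun_prop
  obtain ⟨⟨i₀, j₀⟩, hκ⟩ := Finite.exists_min fun z : ι × ι => K z.1 z.2
  set κ := K i₀ j₀ with hκdef
  have hκ0 : 0 < κ := hK _ _
  set D := ∑ i, |c i| with hD
  have hD0 : 0 ≤ D := Finset.sum_nonneg fun _ _ => abs_nonneg _
  set R := 2 * D / κ with hR
  have hR0 : 0 ≤ R := by positivity
  obtain ⟨β, hβ, hβmin⟩ := (isCompact_Icc (a := (0 : ι → ℝ)) (b := fun _ => R)).exists_isMinOn
    ⟨0, le_rfl, fun _ => hR0⟩ hFc.continuousOn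
  have hβ0 : ∀ i, 0 ≤ β i := fun i => hβ.1 i
  have hF0 : F 0 = 0 := by simp [hF]
  have hglob : ∀ γ : ι → ℝ, (∀ i, 0 ≤ γ i) → F β ≤ F γ := by
    intro γ hγ
    by_cases hbox : ∀ i, γ i ≤ R
    · exact hβmin ⟨fun i => hγ i, fun i => hbox i⟩
    · push Not at hbox
      obtain ⟨i₁, hi₁⟩ := hbox
      refine le_trans (hβmin (show (0 : ι → ℝ) ∈ _ from ⟨le_rfl, fun _ => hR0⟩)) ?_
      rw [hF0]
      set σ := ∑ i, γ i with hσ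
      have hσR : R < σ := hi₁.trans_le (Finset.single_le_sum (fun i _ => hγ i) (Finset.mem_univ i₁))
      have h1 : κ * σ ^ 2 ≤ ∑ i, ∑ j, γ i * γ j * K i j := by
        rw [sq, hσ, Finset.sum_mul_sum, Finset.mul_sum]
        refine Finset.sum_le_sum fun i _ => ?_
        rw [Finset.mul_sum]
        refine Finset.sum_le_sum fun j _ => ?_
        rw [mul_comm]
        exact mul_le_mul_of_nonneg_left (hκ (i, j)) (mul_nonneg (hγ i) (hγ j))
      have h2 : ∑ i, γ i * c i ≤ σ * D := by
        rw [hσ, Finset.sum_mul]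
        refine Finset.sum_le_sum fun i _ => mul_le_mul_of_nonneg_left ?_ (hγ i)
        exact (le_abs_self _).trans (Finset.single_le_sum (f := fun i => |c i|)
          (fun i _ => abs_nonneg _) (Finset.mem_univ i))
      have h3 : 2 * D < κ * σ := by
        rw [hR, div_lt_iff₀ hκ0] at hσR; linarith
      have h4 : 0 ≤ σ := hR0.trans hσR.le
      simp only [hF]
      nlinarith
  -- the variation of `F` in a coordinate direction
  have hvar : ∀ i (ε : ℝ), F (β + (Pi.single i ε : ι → ℝ)) =
      F β + ε * (∑ j, β j * K j i - c i) + ε ^ 2 * K i i / 2 := by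
    intro i ε
    have e1 : ∀ u v : ι, (β + (Pi.single i ε : ι → ℝ)) u * (β + (Pi.single i ε : ι → ℝ)) v * K u v =
        β u * β v * K u v + (if v = i then ε * (β u * K u v) else 0)
        + (if u = i then ε * (β v * K u v) else 0)
        + (if u = i then if v = i then ε ^ 2 * K u v else 0 else 0) := by
      intro u v
      simp only [Pi.add_apply, Pi.single_apply]
      split_ifs <;> ring
    have e2 : ∀ u : ι, (β + (Pi.single i ε : ι → ℝ)) u * c u =
        β u * c u + (if u = i then ε * c u else 0) := by
      intro u
      simp only [Pi.add_apply, Pi.single_apply]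
      split_ifs <;> ring
    have e3 : ∑ u, ∑ v, (if u = i then ε * (β v * K u v) else 0) = ε * ∑ j, β j * K j i := by
      rw [Finset.sum_comm]
      simp only [Finset.sum_ite_eq', Finset.mem_univ, if_true, Finset.mul_sum]
      exact Finset.sum_congr rfl fun j _ => by rw [hsymm i j]
    have e4 : ∑ u, ∑ v, (if u = i then if v = i then ε ^ 2 * K u v else 0 else 0)
        = ε ^ 2 * K i i := by
      rw [Finset.sum_comm]
      simp
    simp only [hF, e1, e2, Finset.sum_add_distrib, e3, e4]
    simp only [Finset.sum_ite_eq', Finset.mem_univ, if_true, ← Finset.mul_sum]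
    ring
  have hgrad : ∀ i (ε : ℝ), 0 ≤ β i + ε →
      0 ≤ ε * (∑ j, β j * K j i - c i) + ε ^ 2 * K i i / 2 := by
    intro i ε hε
    have := hglob (β + (Pi.single i ε : ι → ℝ)) fun u => by
      simp only [Pi.add_apply, Pi.single_apply]
      split_ifs with h
      · exact h ▸ hε
      · simpa using hβ0 u
    rw [hvar] at this
    linarith
  have hnn : ∀ i, c i ≤ ∑ j, β j * K j i := by
    intro i
    by_contra! h
    set w := c i - ∑ j, β j * K j i with hw
    have hw0 : 0 < w := by linarith
    have := hgrad i (w / K i i) (add_nonneg (hβ0 i) (div_nonneg hw0.le (hK i i).le))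
    have hKi := hK i i
    have e : w / K i i * (∑ j, β j * K j i - c i) + (w / K i i) ^ 2 * K i i / 2
        = - (w ^ 2 / (2 * K i i)) := by
      have : ∑ j, β j * K j i - c i = -w := by rw [hw]; ring
      rw [this]; field_simp; ring
    rw [e] at this
    have : 0 < w ^ 2 / (2 * K i i) := by positivity
    linarith
  refine ⟨β, hβ0, hnn, fun i => ?_⟩
  rcases (hβ0 i).eq_or_lt with h | h
  · rw [← h, zero_mul]
  refine mul_eq_zero_of_right _ (le_antisymm ?_ (sub_nonneg.2 (hnn i)))
  by_contra! hw0
  set w := ∑ j, β j * K j i - c i with hw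
  have hKi := hK i i
  set ε := min (β i) (w / K i i) with hε
  have hε0 : 0 < ε := lt_min h (by positivity)
  have h1 := hgrad i (-ε) (by linarith [min_le_left (β i) (w / K i i)])
  have h2 : ε * K i i ≤ w := by
    rw [← le_div_iff₀ hKi]; exact min_le_right _ _
  rw [← hw] at h1
  nlinarith

/-- `β` solves the obstacle problem on `[ℓ, r]` with boundary values `x`, `y` and obstacle `G` on
`P`: the path `chord + potential` with slope drops `β` is concave, lies above the obstacle, and
bends only where it touches the obstacle. These complementarity conditions characterise the least
concave path above the obstacle with these boundary values. -/
structure SolvesObstacle (ℓ r x y : ℝ) (P : Finset ℝ) (G β : ℝ → ℝ) : Prop where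
  nonneg : ∀ p ∈ P, 0 ≤ β p
  above : ∀ p ∈ P, G p ≤ chord ℓ r x y p + potential ℓ r P β p
  touch : ∀ p ∈ P, β p * (chord ℓ r x y p + potential ℓ r P β p - G p) = 0

namespace SolvesObstacle

variable {ℓ r x y x' y' : ℝ} {P : Finset ℝ} {G G' β β' : ℝ → ℝ}

lemma exists_solution (hP : (P : Set ℝ) ⊆ Ioo ℓ r) (x y : ℝ) (G : ℝ → ℝ) :
    ∃ β, SolvesObstacle ℓ r x y P G β := by
  classical
  obtain ⟨β, h0, h1, h2⟩ := exists_complementarity (fun p q : P => bridgeCov ℓ r p q)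
    (fun p q => bridgeCov_pos (hP p.2) (hP q.2)) (fun p q => bridgeCov_comm)
    (fun p => G p - chord ℓ r x y p)
  set γ : ℝ → ℝ := fun p => if h : p ∈ P then β ⟨p, h⟩ else 0 with hγ
  have hγβ : ∀ p : P, γ p = β p := fun p => by simp [hγ]
  have hpot : ∀ p : P, potential ℓ r P γ p = ∑ j, β j * bridgeCov ℓ r j p := by
    intro p
    rw [potential, ← Finset.sum_coe_sort P]
    exact Finset.sum_congr rfl fun q _ => by rw [hγβ]
  refine ⟨γ, fun p hp => ?_, fun p hp => ?_, fun p hp => ?_⟩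
  · rw [hγβ ⟨p, hp⟩]; exact h0 _
  · have := h1 ⟨p, hp⟩
    rw [← hpot] at this
    linarith
  · have := h2 ⟨p, hp⟩
    rw [← hpot, ← hγβ] at this
    simp only at this
    rw [← this]; ring

/-- Comparison principle: raising the boundary values and the obstacle by at least `d` raises the
solution by at least `d`. -/
lemma add_le (hℓr : ℓ < r) (hP : (P : Set ℝ) ⊆ Ioo ℓ r) (h : SolvesObstacle ℓ r x y P G β)
    (h' : SolvesObstacle ℓ r x' y' P G' β') {d : ℝ} (hx : x' + d ≤ x) (hy : y' + d ≤ y)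
    (hG : ∀ p ∈ P, G' p + d ≤ G p) :
    ∀ p ∈ P, chord ℓ r x' y' p + potential ℓ r P β' p + d ≤
      chord ℓ r x y p + potential ℓ r P β p := by
  have hrl : 0 < r - ℓ := by linarith
  have hdiff : ∀ p, chord ℓ r (x - x' - d) (y - y' - d) p + potential ℓ r P (β - β') p =
      (chord ℓ r x y p + potential ℓ r P β p) -
        (chord ℓ r x' y' p + potential ℓ r P β' p) - d := by
    intro p
    have e1 : chord ℓ r (x - x' - d) (y - y' - d) p = chord ℓ r x y p - chord ℓ r x' y' p - d := by
      simp only [chord]; field_simp; ring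
    have e2 : potential ℓ r P (β - β') p = potential ℓ r P β p - potential ℓ r P β' p := by
      simp only [potential, Pi.sub_apply, sub_mul, Finset.sum_sub_distrib]
    rw [e1, e2]; ring
  intro p hp
  have := chord_add_potential_nonneg (x := x - x' - d) (y := y - y' - d) hℓr P hP (by linarith)
    (by linarith) (β - β') (fun q hq hneg => by
      rw [hdiff] at hneg
      -- where the gap is too small the lower path lies strictly above its obstacle
      have h1 := h.above q hq
      have h2 := hG q hq
      have h3 : β' q = 0 := (mul_eq_zero.1 (h'.touch q hq)).resolve_right (by
        intro h4; linarith)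
      simpa [h3] using h.nonneg q hq) p hp
  rw [hdiff] at this
  linarith

/-- If the obstacle lies below the lines of slope `M` and `-M` issuing from the two boundary values,
then the total slope drop of the solution is at most `2 M`: the first touching point forces its
initial slope to be at most `M`, the last one its final slope to be at least `-M`, and if there is
no touching point then the solution is affine. -/
lemma sum_le (hℓr : ℓ < r) (hP : (P : Set ℝ) ⊆ Ioo ℓ r) (h : SolvesObstacle ℓ r x y P G β)
    {M : ℝ} (hM : 0 ≤ M) (hGl : ∀ p ∈ P, G p ≤ x + M * (p - ℓ))
    (hGr : ∀ p ∈ P, G p ≤ y + M * (r - p)) : ∑ p ∈ P, β p ≤ 2 * M := by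
  have hrl : 0 < r - ℓ := by linarith
  rcases (P.filter fun p => β p ≠ 0).eq_empty_or_nonempty with he | hne
  · rw [Finset.filter_eq_empty_iff] at he
    rw [Finset.sum_eq_zero fun p hp => not_not.1 (he hp)]
    linarith
  obtain ⟨a, ha, hamin⟩ := Finset.exists_min_image _ id hne
  obtain ⟨b, hb, hbmax⟩ := Finset.exists_max_image _ id hne
  simp only [Finset.mem_filter, id] at ha hb hamin hbmax
  have ta : chord ℓ r x y a + potential ℓ r P β a - G a = 0 :=
    (mul_eq_zero.1 (h.touch a ha.1)).resolve_left ha.2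
  have tb : chord ℓ r x y b + potential ℓ r P β b - G b = 0 :=
    (mul_eq_zero.1 (h.touch b hb.1)).resolve_left hb.2
  have pa : potential ℓ r P β a = (a - ℓ) / (r - ℓ) * ∑ p ∈ P, β p * (r - p) := by
    rw [potential, Finset.mul_sum]
    refine Finset.sum_congr rfl fun p hp => ?_
    by_cases h0 : β p = 0
    · simp [h0]
    · rw [bridgeCov_of_ge (hamin p ⟨hp, h0⟩)]; ring
  have pb : potential ℓ r P β b = (r - b) / (r - ℓ) * ∑ p ∈ P, β p * (p - ℓ) := by
    rw [potential, Finset.mul_sum]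
    refine Finset.sum_congr rfl fun p hp => ?_
    by_cases h0 : β p = 0
    · simp [h0]
    · rw [bridgeCov_of_le (hbmax p ⟨hp, h0⟩)]; ring
  have haP := hP ha.1
  have hbP := hP hb.1
  have ca : chord ℓ r x y a = x + (a - ℓ) / (r - ℓ) * (y - x) := by
    rw [chord]; field_simp; ring
  have cb : chord ℓ r x y b = y + (r - b) / (r - ℓ) * (x - y) := by
    rw [chord]; field_simp; ring
  have ia : (y - x) + ∑ p ∈ P, β p * (r - p) ≤ M * (r - ℓ) := by
    have h1 : (a - ℓ) / (r - ℓ) * ((y - x) + ∑ p ∈ P, β p * (r - p)) ≤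
        (a - ℓ) / (r - ℓ) * (M * (r - ℓ)) := by
      have e : (a - ℓ) / (r - ℓ) * (M * (r - ℓ)) = M * (a - ℓ) := by field_simp
      rw [e, mul_add]
      linarith [hGl a ha.1]
    exact le_of_mul_le_mul_left h1 (div_pos (sub_pos.2 haP.1) hrl)
  have ib : (x - y) + ∑ p ∈ P, β p * (p - ℓ) ≤ M * (r - ℓ) := by
    have h1 : (r - b) / (r - ℓ) * ((x - y) + ∑ p ∈ P, β p * (p - ℓ)) ≤
        (r - b) / (r - ℓ) * (M * (r - ℓ)) := by
      have e : (r - b) / (r - ℓ) * (M * (r - ℓ)) = M * (r - b) := by field_simp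
      rw [e, mul_add]
      linarith [hGr b hb.1]
    exact le_of_mul_le_mul_left h1 (div_pos (sub_pos.2 hbP.2) hrl)
  have hs : ∑ p ∈ P, β p * (r - p) + ∑ p ∈ P, β p * (p - ℓ) = (r - ℓ) * ∑ p ∈ P, β p := by
    rw [← Finset.sum_add_distrib, Finset.mul_sum]
    exact Finset.sum_congr rfl fun p _ => by ring
  have : (r - ℓ) * ∑ p ∈ P, β p ≤ (r - ℓ) * (2 * M) := by linarith
  exact le_of_mul_le_mul_left this hrl

end SolvesObstacle

/-! ### Gaussian vectors -/

section GaussianReal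

/-- A Gaussian density absorbs a shift by the variance into an exponential factor. -/
lemma lintegral_gaussianReal_sub_var (v : ℝ≥0) {h : ℝ → ℝ≥0∞} (hh : Measurable h) :
    ∫⁻ y, h (y - v) ∂gaussianReal 0 v =
      ∫⁻ y, ENNReal.ofReal (Real.exp (-y - v / 2)) * h y ∂gaussianReal 0 v := by
  rcases eq_or_ne v 0 with rfl | hv
  · simp [lintegral_dirac]
  rw [gaussianReal_of_var_ne_zero 0 hv,
    lintegral_withDensity_eq_lintegral_mul _ (measurable_gaussianPDF 0 v) (by fun_prop),
    lintegral_withDensity_eq_lintegral_mul _ (measurable_gaussianPDF 0 v) (by fun_prop),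
    ← lintegral_add_right_eq_self (μ := volume) _ (v : ℝ)]
  refine lintegral_congr fun y => ?_
  have hv' : (v : ℝ) ≠ 0 := by exact_mod_cast hv
  simp only [Pi.mul_apply, add_sub_cancel_right, ← mul_assoc]
  congr 1
  rw [gaussianPDF, gaussianPDF, ← ENNReal.ofReal_mul (gaussianPDFReal_nonneg _ _ _),
    gaussianPDFReal, gaussianPDFReal, mul_assoc _ (Real.exp _) (Real.exp _), ← Real.exp_add]
  congr 3
  field_simp
  ring

lemma le_gaussianReal_Icc {v : ℝ≥0} {a c : ℝ} (h : a * √v ≤ c) :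
    gaussianReal 0 1 (Icc 0 a) ≤ gaussianReal 0 v (Icc 0 c) := by
  have hmap : gaussianReal 0 v = (gaussianReal 0 1).map (√v * ·) := by
    rw [gaussianReal_map_const_mul]
    congr 1
    · simp
    · ext; simp
  rw [hmap, Measure.map_apply (by fun_prop) measurableSet_Icc]
  refine measure_mono fun x hx => ⟨mul_nonneg (Real.sqrt_nonneg _) hx.1, ?_⟩
  calc √v * x ≤ √v * a := mul_le_mul_of_nonneg_left hx.2 (Real.sqrt_nonneg _)
    _ ≤ c := by rw [mul_comm]; exact h

lemma gaussianReal_zero_Icc_neg (v : ℝ≥0) (c : ℝ) :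
    gaussianReal 0 v (Icc (-c) 0) = gaussianReal 0 v (Icc 0 c) := by
  conv_lhs => rw [← neg_zero, ← gaussianReal_map_neg]
  rw [Measure.map_apply (by fun_prop) measurableSet_Icc]
  congr 1
  ext x
  simp only [mem_preimage, mem_Icc]
  constructor <;> rintro ⟨h1, h2⟩ <;> constructor <;> linarith

lemma gaussianReal_Icc_pos {a : ℝ} (ha : 0 < a) : 0 < gaussianReal 0 1 (Icc 0 a) := by
  rw [pos_iff_ne_zero]
  intro h
  have h2 := gaussianReal_absolutelyContinuous' 0 (one_ne_zero (α := ℝ≥0)) h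
  rw [Real.volume_Icc, sub_zero, ENNReal.ofReal_eq_zero] at h2
  linarith

end GaussianReal

section GaussianVector

variable {Ω : Type*} [MeasurableSpace Ω] {ν : Measure Ω} {ι : Type*} [Fintype ι]
  {V : ι → Ω → ℝ}

lemma gaussian_sum_hasGaussianLaw (hV : HasGaussianLaw (fun ω i => V i ω) ν) (β : ι → ℝ) :
    HasGaussianLaw (fun ω => ∑ i, β i * V i ω) ν := by
  have := hV.map_fun (∑ i, β i • ContinuousLinearMap.proj (R := ℝ) (φ := fun _ : ι => ℝ) i)
  simpa using this

/-- Two linear images of a Gaussian vector are independent as soon as they are uncorrelated. -/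
lemma indepFun_linear_of_covariance_eq_zero {κ : Type*} [Finite κ]
    (hV : HasGaussianLaw (fun ω i => V i ω) ν) (A : (ι → ℝ) →L[ℝ] (κ → ℝ)) (a : (ι → ℝ) →L[ℝ] ℝ)
    (h : ∀ k, cov[fun ω => A (fun i => V i ω) k, fun ω => a (fun i => V i ω); ν] = 0) :
    IndepFun (fun ω => A (fun i => V i ω)) (fun ω => a (fun i => V i ω)) ν := by
  have := Fintype.ofFinite κ
  have hL := hV.map_fun (A.prod (ContinuousLinearMap.pi fun _ : Unit => a))
  have := HasGaussianLaw.indepFun_of_covariance_eval (P := ν)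
    (X := fun k ω => A (fun i => V i ω) k) (Y := fun (_ : Unit) ω => a (fun i => V i ω)) hL
    fun k _ => h k
  exact this.comp measurable_id (measurable_pi_apply ())

/-- Exponential Chebyshev bound for a centred Gaussian linear form. -/
lemma measure_linear_ge_le (hV : HasGaussianLaw (fun ω i => V i ω) ν)
    (hmean : ∀ i, ∫ ω, V i ω ∂ν = 0) (β : ι → ℝ) (a : ℝ) :
    ν.real {ω | a ≤ ∑ i, β i * V i ω} ≤
      Real.exp (Var[fun ω => ∑ i, β i * V i ω; ν] / 2 - a) := by
  have := hV.isProbabilityMeasure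
  have hY := gaussian_sum_hasGaussianLaw hV β
  have hY0 : ∫ ω, ∑ i, β i * V i ω ∂ν = 0 := by
    rw [integral_finsetSum _ fun i _ => (hV.eval i).integrable.const_mul _]
    simp [integral_const_mul, hmean]
  have hlaw := hY.map_eq_gaussianReal
  rw [hY0] at hlaw
  have hint : Integrable (fun ω => Real.exp (1 * ∑ i, β i * V i ω)) ν := by
    have := integrable_exp_mul_gaussianReal (μ := 0)
      (v := (Var[fun ω => ∑ i, β i * V i ω; ν]).toNNReal) 1
    rw [← hlaw, integrable_map_measure (by fun_prop) hY.aemeasurable] at this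
    exact this
  refine (measure_ge_le_exp_mul_mgf a zero_le_one hint).trans (le_of_eq ?_)
  rw [mgf_gaussianReal hlaw, ← Real.exp_add, Real.coe_toNNReal _ (variance_nonneg _ _)]
  congr 1
  ring

/-- Cameron–Martin bound: translating the centred Gaussian vector `V` by its covariance with the
linear form `Y = ∑ β i * V i` costs at most `exp (-Var Y / 2 - c ∑ β i)` on a cube of radius `c`.
Up to a multiple of `Y`, the vector `V` is independent of `Y`, so that the translation is a
one-dimensional shift of the law of `Y`. -/
lemma measure_cube_shift_ge (hV : HasGaussianLaw (fun ω i => V i ω) ν)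
    (hmeas : ∀ i, Measurable (V i)) (hmean : ∀ i, ∫ ω, V i ω ∂ν = 0)
    (β : ι → ℝ) (hβ : ∀ i, 0 ≤ β i) {c : ℝ} {φ : ι → ℝ}
    (hφ : ∀ i, cov[V i, fun ω => ∑ j, β j * V j ω; ν] = φ i) :
    ENNReal.ofReal (Real.exp (-(Var[fun ω => ∑ i, β i * V i ω; ν] / 2) - c * ∑ i, β i)) *
      ν {ω | ∀ i, |V i ω| ≤ c} ≤ ν {ω | ∀ i, |V i ω - φ i| ≤ c} := by
  have := hV.isProbabilityMeasure
  have hY := gaussian_sum_hasGaussianLaw hV β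
  have hYm : Measurable fun ω => ∑ i, β i * V i ω := by fun_prop
  set Y : Ω → ℝ := fun ω => ∑ i, β i * V i ω with hYdef
  have hY0 : ∫ ω, Y ω ∂ν = 0 := by
    rw [hYdef, integral_finsetSum _ fun i _ => (hV.eval i).integrable.const_mul _]
    simp [integral_const_mul, hmean]
  set v : ℝ≥0 := (Var[Y; ν]).toNNReal with hv
  have hvar : Var[Y; ν] = v := (Real.coe_toNNReal _ (variance_nonneg _ _)).symm
  have hlaw : ν.map Y = gaussianReal 0 v := by rw [hY.map_eq_gaussianReal, hY0]
  -- if `Y` is degenerate, then it has no covariance with anything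
  have hφ0 : (v : ℝ) = 0 → ∀ i, φ i = 0 := by
    intro h i
    have h1 := ae_eq_integral_of_variance_eq_zero hY.memLp_two (hvar.trans h)
    rw [← hφ i, covariance]
    refine integral_eq_zero_of_ae ?_
    filter_upwards [h1] with ω hω
    simp [hω]
  have hcancel : ∀ i, φ i / v * v = φ i := fun i => by
    by_cases h : (v : ℝ) = 0
    · rw [h, hφ0 h i]; simp
    · field_simp
  set a : (ι → ℝ) →L[ℝ] ℝ :=
    ∑ i, β i • ContinuousLinearMap.proj (R := ℝ) (φ := fun _ : ι => ℝ) i with ha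
  set A : (ι → ℝ) →L[ℝ] (ι → ℝ) := ContinuousLinearMap.pi fun i =>
    ContinuousLinearMap.proj i - (φ i / v) • a with hA
  have haV : ∀ ω, a (fun i => V i ω) = Y ω := fun ω => by simp [ha, hYdef]
  have hAV : ∀ ω i, A (fun i => V i ω) i = V i ω - φ i / v * Y ω := fun ω i => by
    rw [hA, ContinuousLinearMap.pi_apply, sub_apply,
      smul_apply, haV]
    simp
  have hind : IndepFun (fun ω i => V i ω - φ i / v * Y ω) Y ν := by
    have := indepFun_linear_of_covariance_eq_zero hV A a fun i => by
      simp only [haV, hAV]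
      rw [covariance_fun_sub_left (hV.eval i).memLp_two (hY.memLp_two.const_mul _) hY.memLp_two,
        covariance_const_mul_left, covariance_self hY.aemeasurable, hφ, hvar, hcancel, sub_self]
    have e : (fun ω => A (fun i => V i ω)) = fun ω i => V i ω - φ i / v * Y ω := by
      ext ω i; exact hAV ω i
    have e' : (fun ω => a (fun i => V i ω)) = Y := funext haV
    rwa [e, e'] at this
  set Z : Ω → ι → ℝ := fun ω i => V i ω - φ i / v * Y ω with hZ
  have hZm : Measurable Z := by fun_prop
  have hjoint : ν.map (fun ω => (Z ω, Y ω)) = (ν.map Z).prod (gaussianReal 0 v) := by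
    rw [(indepFun_iff_map_prod_eq_prod_map_map hZm.aemeasurable hYm.aemeasurable).1 hind, hlaw]
  set S : Set ((ι → ℝ) × ℝ) := {w | ∀ i, |w.1 i + φ i / v * w.2| ≤ c} with hS
  have hSm : MeasurableSet S := by
    rw [hS, ofPred_forall]
    exact MeasurableSet.iInter fun i => measurableSet_le (by fun_prop) measurable_const
  have hS1 : ∀ ω, (Z ω, Y ω) ∈ S ↔ ∀ i, |V i ω| ≤ c := fun ω => by
    simp only [hS, hZ, mem_ofPred_eq, sub_add_cancel]
  have hS2 : ∀ ω, (Z ω, Y ω - v) ∈ S ↔ ∀ i, |V i ω - φ i| ≤ c := fun ω => by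
    simp only [hS, hZ, mem_ofPred_eq]
    refine forall_congr' fun i => ?_
    rw [mul_sub, hcancel, ← add_sub_assoc, sub_add_cancel]
  have hind1 : Measurable (S.indicator (fun _ => (1 : ℝ≥0∞))) := measurable_const.indicator hSm
  have hm1 : Measurable fun w : (ι → ℝ) × ℝ => S.indicator (fun _ => (1 : ℝ≥0∞)) (w.1, w.2 - v) :=
    hind1.comp (by fun_prop)
  have hm2 : Measurable fun w : (ι → ℝ) × ℝ => ENNReal.ofReal (Real.exp (-w.2 - v / 2)) *
      S.indicator (fun _ => (1 : ℝ≥0∞)) w := Measurable.mul (by fun_prop) hind1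
  have key : ν {ω | ∀ i, |V i ω - φ i| ≤ c} =
      ∫⁻ ω, ENNReal.ofReal (Real.exp (-Y ω - v / 2)) *
        {ω | ∀ i, |V i ω| ≤ c}.indicator (fun _ => (1 : ℝ≥0∞)) ω ∂ν := by
    have hA'm : MeasurableSet {ω | ∀ i, |V i ω - φ i| ≤ c} := by
      rw [ofPred_forall]
      exact MeasurableSet.iInter fun i => measurableSet_le (by fun_prop) measurable_const
    calc ν {ω | ∀ i, |V i ω - φ i| ≤ c}
        = ∫⁻ ω, S.indicator (fun _ => (1 : ℝ≥0∞)) (Z ω, Y ω - v) ∂ν := by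
          rw [← lintegral_indicator_one hA'm]
          refine lintegral_congr fun ω => ?_
          simp only [indicator_apply, hS2, mem_ofPred_eq, Pi.one_apply]
      _ = ∫⁻ w, S.indicator (fun _ => (1 : ℝ≥0∞)) (w.1, w.2 - v) ∂(ν.map fun ω => (Z ω, Y ω)) :=
          (lintegral_map hm1 (hZm.prodMk hYm)).symm
      _ = ∫⁻ z, ∫⁻ y, S.indicator (fun _ => (1 : ℝ≥0∞)) (z, y - v) ∂gaussianReal 0 v
            ∂(ν.map Z) := by
          rw [hjoint, lintegral_prod _ hm1.aemeasurable]
      _ = ∫⁻ z, ∫⁻ y, ENNReal.ofReal (Real.exp (-y - v / 2)) *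
            S.indicator (fun _ => (1 : ℝ≥0∞)) (z, y) ∂gaussianReal 0 v ∂(ν.map Z) := by
          refine lintegral_congr fun z => ?_
          exact lintegral_gaussianReal_sub_var v
            (h := fun y => S.indicator (fun _ => (1 : ℝ≥0∞)) (z, y))
            (hind1.comp measurable_prodMk_left)
      _ = ∫⁻ w, ENNReal.ofReal (Real.exp (-w.2 - v / 2)) *
            S.indicator (fun _ => (1 : ℝ≥0∞)) w ∂(ν.map fun ω => (Z ω, Y ω)) := by
          rw [hjoint, lintegral_prod _ hm2.aemeasurable]
      _ = _ := by
          rw [lintegral_map hm2 (hZm.prodMk hYm)]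
          refine lintegral_congr fun ω => ?_
          simp only [indicator_apply, hS1, mem_ofPred_eq]
  have hAm : MeasurableSet {ω | ∀ i, |V i ω| ≤ c} := by
    rw [ofPred_forall]
    exact MeasurableSet.iInter fun i => measurableSet_le (by fun_prop) measurable_const
  rw [key, ← lintegral_indicator_one hAm, ← lintegral_const_mul' _ _ ENNReal.ofReal_ne_top]
  refine lintegral_mono fun ω => ?_
  by_cases hω : ∀ i, |V i ω| ≤ c
  · simp only [indicator_apply, mem_ofPred_eq, hω, implies_true, if_true, Pi.one_apply, mul_one]
    refine ENNReal.ofReal_le_ofReal (Real.exp_le_exp.2 ?_)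
    have : Y ω ≤ c * ∑ i, β i := by
      rw [Finset.mul_sum]
      refine Finset.sum_le_sum fun i _ => ?_
      rw [mul_comm c]
      exact mul_le_mul_of_nonneg_left ((le_abs_self _).trans (hω i)) (hβ i)
    rw [hvar]
    linarith
  · simp only [indicator_apply, mem_ofPred_eq, if_neg hω, mul_zero, le_refl]

end GaussianVector

/-! ### Brownian bridges at finitely many times -/

namespace IsBrownianBridge

variable {Ω : Type*} [MeasurableSpace Ω] {ν : Measure Ω} {ℓ r x y : ℝ} {B : ℝ → Ω → ℝ}
  {P : Finset ℝ}

lemma hasGaussianLaw_restrict (h : IsBrownianBridge ν ℓ r x y B)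
    (hP : (P : Set ℝ) ⊆ Icc ℓ r) : HasGaussianLaw (fun ω (p : P) => B p ω) ν := by
  have h1 := (h.gaussian.comp_right fun p : P => (⟨p, hP p.2⟩ : Icc ℓ r)).hasGaussianLaw
    Finset.univ
  exact h1.map_fun (ContinuousLinearMap.pi fun p : P =>
    ContinuousLinearMap.proj (R := ℝ) (φ := fun _ : (Finset.univ : Finset P) => ℝ)
      ⟨p, Finset.mem_univ p⟩)

lemma hasGaussianLaw (h : IsBrownianBridge ν ℓ r x y B) {t : ℝ} (ht : t ∈ Icc ℓ r) :
    HasGaussianLaw (B t) ν :=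
  h.gaussian.hasGaussianLaw_eval ⟨t, ht⟩

lemma cov_eq (h : IsBrownianBridge ν ℓ r x y B) {s t : ℝ} (hs : s ∈ Icc ℓ r) (ht : t ∈ Icc ℓ r) :
    cov[B s, B t; ν] = bridgeCov ℓ r s t := by
  rcases le_total s t with hst | hst
  · rw [h.covariance s hs t ht hst, bridgeCov_of_le hst]
  · rw [covariance_comm, h.covariance t ht s hs hst, bridgeCov_of_ge hst]

/-- Subtracting the affine interpolation turns a bridge into one from `0` to `0`. -/
lemma sub_chord (h : IsBrownianBridge ν ℓ r x y B) :
    IsBrownianBridge ν ℓ r 0 0 fun t ω => B t ω - chord ℓ r x y t := by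
  have := h.gaussian.isProbabilityMeasure
  refine ⟨fun t ht => (h.measurable t ht).sub_const _, ⟨fun I => ?_⟩, fun t ht => ?_,
    fun s hs t ht hst => ?_, ?_⟩
  · have h1 := h.gaussian.hasGaussianLaw I
    have := h1.isGaussian_map
    constructor
    have e : (fun ω => I.restrict fun t : Icc ℓ r => B t ω - chord ℓ r x y t) =
        (fun v => v - fun t : I => chord ℓ r x y t) ∘ fun ω => I.restrict fun t : Icc ℓ r => B t ω := by
      ext ω t; simp
    rw [e, ← AEMeasurable.map_map_of_aemeasurable (by fun_prop) h1.aemeasurable]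
    infer_instance
  · rw [integral_sub (h.hasGaussianLaw ht).integrable (integrable_const _), h.mean t ht]
    simp [chord]
  · rw [covariance_sub_const_left (h.hasGaussianLaw hs).integrable,
      covariance_sub_const_right (h.hasGaussianLaw ht).integrable, h.covariance s hs t ht hst]
  · filter_upwards [h.continuous_paths] with ω hω
    exact hω.sub (by unfold chord; fun_prop)

lemma integral_eq_zero (h : IsBrownianBridge ν ℓ r 0 0 B) {t : ℝ} (ht : t ∈ Icc ℓ r) :
    ∫ ω, B t ω ∂ν = 0 := by
  rw [h.mean t ht]; simp

lemma cov_sum (h : IsBrownianBridge ν ℓ r 0 0 B) (hP : (P : Set ℝ) ⊆ Icc ℓ r) (β : ℝ → ℝ) {t : ℝ}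
    (ht : t ∈ Icc ℓ r) :
    cov[B t, fun ω => ∑ p : P, β p * B p ω; ν] = potential ℓ r P β t := by
  have := h.gaussian.isProbabilityMeasure
  have hm : ∀ p : P, MemLp (B p) 2 ν := fun p => (h.hasGaussianLaw (hP p.2)).memLp_two
  rw [covariance_fun_sum_right (X := fun (p : P) ω => β p * B p ω)
    (fun p => (hm p).const_mul _) (h.hasGaussianLaw ht).memLp_two, potential,
    ← Finset.sum_coe_sort P]
  refine Finset.sum_congr rfl fun p _ => ?_
  rw [covariance_const_mul_right, h.cov_eq ht (hP p.2), bridgeCov_comm]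

lemma var_sum (h : IsBrownianBridge ν ℓ r 0 0 B) (hP : (P : Set ℝ) ⊆ Icc ℓ r) (β : ℝ → ℝ) :
    Var[fun ω => ∑ p : P, β p * B p ω; ν] = ∑ p ∈ P, β p * potential ℓ r P β p := by
  have := h.gaussian.isProbabilityMeasure
  have hm : ∀ p : P, MemLp (B p) 2 ν := fun p => (h.hasGaussianLaw (hP p.2)).memLp_two
  have hs : MemLp (fun ω => ∑ p : P, β p * B p ω) 2 ν :=
    memLp_finsetSum _ fun p _ => (hm p).const_mul _
  rw [← covariance_self hs.aemeasurable,
    covariance_fun_sum_left (X := fun (p : P) ω => β p * B p ω) (fun p => (hm p).const_mul _) hs,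
    ← Finset.sum_coe_sort P]
  refine Finset.sum_congr rfl fun p _ => ?_
  rw [covariance_const_mul_left, h.cov_sum hP β (hP p.2)]

/-- One step of the small ball estimate. Given the values at times up to `q`, the bridge at time
`p > q` is `(r - p) / (r - q)` times its value at `q` plus an independent centred Gaussian, which
pushes the bridge towards `0` with a probability bounded below. -/
lemma measure_insert_ge (h : IsBrownianBridge ν ℓ r 0 0 B) (hP : (P : Set ℝ) ⊆ Ioo ℓ r) {q p : ℝ}
    (hq : q ∈ P) (hqmax : ∀ s ∈ P, s ≤ q) (hp : p ∈ Ioo ℓ r) (hqp : q < p) {a c : ℝ} (ha : 0 ≤ a)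
    (hac : a * √(r - ℓ) ≤ c) :
    gaussianReal 0 1 (Icc 0 a) * ν {ω | ∀ s ∈ P, |B s ω| ≤ c} ≤
      ν {ω | (∀ s ∈ P, |B s ω| ≤ c) ∧ |B p ω| ≤ c} := by
  have := h.gaussian.isProbabilityMeasure
  have hPI : (P : Set ℝ) ⊆ Icc ℓ r := hP.trans Ioo_subset_Icc_self
  have hpI := Ioo_subset_Icc_self hp
  have hqI := Ioo_subset_Icc_self (hP hq)
  have hqr : 0 < r - q := by linarith [hp.2]
  have hrl : 0 < r - ℓ := by linarith [hp.1, hp.2]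
  set ρ := (r - p) / (r - q) with hρ
  have hρ0 : 0 ≤ ρ := div_nonneg (by linarith [hp.2]) hqr.le
  have hρ1 : ρ ≤ 1 := by rw [hρ, div_le_one hqr]; linarith
  set ξ : Ω → ℝ := fun ω => B p ω - ρ * B q ω with hξ
  have hBp := (h.hasGaussianLaw hpI)
  have hBq := (h.hasGaussianLaw hqI)
  have hcov : ∀ {t : ℝ}, t ∈ Icc ℓ r →
      cov[B t, ξ; ν] = bridgeCov ℓ r t p - ρ * bridgeCov ℓ r t q := fun ht => by
    rw [hξ, covariance_fun_sub_right (h.hasGaussianLaw ht).memLp_two hBp.memLp_two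
      (hBq.memLp_two.const_mul _), covariance_const_mul_right, h.cov_eq ht hpI, h.cov_eq ht hqI]
  have hins : ((insert p P : Finset ℝ) : Set ℝ) ⊆ Icc ℓ r := by
    rw [Finset.coe_insert]; exact insert_subset hpI hPI
  have hV := h.hasGaussianLaw_restrict hins
  set A : (↥(insert p P) → ℝ) →L[ℝ] (P → ℝ) := ContinuousLinearMap.pi fun s =>
    ContinuousLinearMap.proj (R := ℝ) (φ := fun _ : ↥(insert p P) => ℝ)
      ⟨s, Finset.mem_insert_of_mem s.2⟩ with hA
  set b : (↥(insert p P) → ℝ) →L[ℝ] ℝ :=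
    ContinuousLinearMap.proj (R := ℝ) (φ := fun _ : ↥(insert p P) => ℝ)
      ⟨p, Finset.mem_insert_self p P⟩ -
      ρ • ContinuousLinearMap.proj (R := ℝ) (φ := fun _ : ↥(insert p P) => ℝ)
        ⟨q, Finset.mem_insert_of_mem hq⟩ with hb
  have hind : IndepFun (fun ω (s : P) => B s ω) ξ ν := by
    refine indepFun_linear_of_covariance_eq_zero hV A b fun s => ?_
    change cov[B s, ξ; ν] = 0
    have hsq := hqmax s s.2
    rw [hcov (hPI s.2), bridgeCov_of_le hsq, bridgeCov_of_le (hsq.trans hqp.le), hρ]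
    field_simp
    ring
  have hξG : HasGaussianLaw ξ ν := hV.map_fun b
  have hξ0 : ∫ ω, ξ ω ∂ν = 0 := by
    rw [hξ, integral_sub hBp.integrable (hBq.integrable.const_mul _), integral_const_mul,
      h.integral_eq_zero hpI, h.integral_eq_zero hqI]
    simp
  have hvar : Var[ξ; ν] ≤ r - ℓ := by
    have e : Var[ξ; ν] = (p - q) * (r - p) / (r - q) := by
      have e' : Var[ξ; ν] = cov[B p, ξ; ν] - ρ * cov[B q, ξ; ν] := by
        rw [← covariance_self hξG.aemeasurable, ← covariance_const_mul_left,
          ← covariance_fun_sub_left hBp.memLp_two (hBq.memLp_two.const_mul _) hξG.memLp_two]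
      rw [e', hcov hpI, hcov hqI, bridgeCov_of_le le_rfl, bridgeCov_of_le le_rfl,
        bridgeCov_of_le hqp.le, bridgeCov_of_ge hqp.le, hρ]
      field_simp
      ring
    rw [e, div_le_iff₀ hqr]
    have := hp.2
    have := (hP hq).1
    nlinarith
  have hlaw : ν.map ξ = gaussianReal 0 (Var[ξ; ν]).toNNReal := by
    rw [hξG.map_eq_gaussianReal, hξ0]
  have hξm : Measurable ξ := (h.measurable p hpI).sub ((h.measurable q hqI).const_mul _)
  have hlow : gaussianReal 0 1 (Icc 0 a) ≤ gaussianReal 0 (Var[ξ; ν]).toNNReal (Icc 0 c) := by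
    refine le_gaussianReal_Icc (le_trans (mul_le_mul_of_nonneg_left ?_ ha) hac)
    refine Real.sqrt_le_sqrt ?_
    rw [Real.coe_toNNReal _ (variance_nonneg _ _)]
    exact hvar
  have hpos : gaussianReal 0 1 (Icc 0 a) ≤ ν (ξ ⁻¹' Icc 0 c) := by
    rwa [← Measure.map_apply hξm measurableSet_Icc, hlaw]
  have hneg : gaussianReal 0 1 (Icc 0 a) ≤ ν (ξ ⁻¹' Icc (-c) 0) := by
    rwa [← Measure.map_apply hξm measurableSet_Icc, hlaw, gaussianReal_zero_Icc_neg]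
  -- split according to the sign of the bridge at time `q`
  set S₁ : Set (P → ℝ) := {u | (∀ s, |u s| ≤ c) ∧ 0 ≤ u ⟨q, hq⟩} with hS₁
  set S₂ : Set (P → ℝ) := {u | (∀ s, |u s| ≤ c) ∧ u ⟨q, hq⟩ < 0} with hS₂
  have hcube : MeasurableSet {u : P → ℝ | ∀ s, |u s| ≤ c} := by
    rw [ofPred_forall]
    exact MeasurableSet.iInter fun i => measurableSet_le (by fun_prop) measurable_const
  have hS₁m : MeasurableSet S₁ :=
    hcube.inter (measurableSet_le measurable_const (measurable_pi_apply _))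
  have hS₂m : MeasurableSet S₂ :=
    hcube.inter (measurableSet_lt (measurable_pi_apply _) measurable_const)
  set U : Ω → P → ℝ := fun ω s => B s ω with hU
  have hUm : Measurable U := measurable_pi_lambda _ fun s => h.measurable s (hPI s.2)
  have hsplit : ν {ω | ∀ s ∈ P, |B s ω| ≤ c} ≤ ν (U ⁻¹' S₁) + ν (U ⁻¹' S₂) := by
    refine le_trans (measure_mono fun ω hω => ?_) (measure_union_le _ _)
    rcases le_or_gt 0 (B q ω) with h0 | h0
    · exact Or.inl ⟨fun s => hω s s.2, h0⟩
    · exact Or.inr ⟨fun s => hω s s.2, h0⟩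
  have hdisj : Disjoint (U ⁻¹' S₁ ∩ ξ ⁻¹' Icc (-c) 0) (U ⁻¹' S₂ ∩ ξ ⁻¹' Icc 0 c) := by
    rw [Set.disjoint_left]
    rintro ω ⟨h1, -⟩ ⟨h2, -⟩
    exact absurd h2.2 (not_lt.2 h1.2)
  calc gaussianReal 0 1 (Icc 0 a) * ν {ω | ∀ s ∈ P, |B s ω| ≤ c}
      ≤ gaussianReal 0 1 (Icc 0 a) * (ν (U ⁻¹' S₁) + ν (U ⁻¹' S₂)) := by gcongr
    _ ≤ ν (U ⁻¹' S₁) * ν (ξ ⁻¹' Icc (-c) 0) + ν (U ⁻¹' S₂) * ν (ξ ⁻¹' Icc 0 c) := by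
        rw [mul_add, mul_comm _ (ν (U ⁻¹' S₁)), mul_comm _ (ν (U ⁻¹' S₂))]
        gcongr
    _ = ν (U ⁻¹' S₁ ∩ ξ ⁻¹' Icc (-c) 0) + ν (U ⁻¹' S₂ ∩ ξ ⁻¹' Icc 0 c) := by
        rw [hind.measure_inter_preimage_eq_mul _ _ hS₁m measurableSet_Icc,
          hind.measure_inter_preimage_eq_mul _ _ hS₂m measurableSet_Icc]
    _ = ν (U ⁻¹' S₁ ∩ ξ ⁻¹' Icc (-c) 0 ∪ U ⁻¹' S₂ ∩ ξ ⁻¹' Icc 0 c) :=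
        (measure_union hdisj ((hUm hS₂m).inter (hξm measurableSet_Icc))).symm
    _ ≤ _ := by
        refine measure_mono fun ω hω => ?_
        have hBξ : B p ω = ρ * B q ω + ξ ω := by simp [hξ]
        rcases hω with ⟨⟨hc, h0⟩, h1, h2⟩ | ⟨⟨hc, h0⟩, h1, h2⟩
        · refine ⟨fun s hs => hc ⟨s, hs⟩, ?_⟩
          have h3 := (abs_le.1 (hc ⟨q, hq⟩)).2
          change 0 ≤ B q ω at h0
          change B q ω ≤ c at h3
          rw [hBξ, abs_le]
          constructor <;> nlinarith
        · refine ⟨fun s hs => hc ⟨s, hs⟩, ?_⟩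
          have h3 := (abs_le.1 (hc ⟨q, hq⟩)).1
          change B q ω < 0 at h0
          change -c ≤ B q ω at h3
          rw [hBξ, abs_le]
          constructor <;> nlinarith

/-- Small ball estimate at finitely many times: the constant per time depends only on the ratio of
the radius to the square root of the length of the interval. -/
lemma measure_cube_ge (h : IsBrownianBridge ν ℓ r 0 0 B) (hP : (P : Set ℝ) ⊆ Ioo ℓ r) {a c : ℝ}
    (ha : 0 ≤ a) (hac : a * √(r - ℓ) ≤ c) :
    gaussianReal 0 1 (Icc 0 a) ^ P.card ≤ ν {ω | ∀ s ∈ P, |B s ω| ≤ c} := by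
  have := h.gaussian.isProbabilityMeasure
  induction P using Finset.induction_on_max with
  | empty => simp
  | insert p P hmax ih =>
    rw [Finset.coe_insert, insert_subset_iff] at hP
    have hcard : (insert p P).card = P.card + 1 :=
      Finset.card_insert_of_notMem fun hp => lt_irrefl _ (hmax p hp)
    have hset : {ω | ∀ s ∈ insert p P, |B s ω| ≤ c} =
        {ω | (∀ s ∈ P, |B s ω| ≤ c) ∧ |B p ω| ≤ c} := by
      ext ω; simp [and_comm]
    rw [hcard, pow_succ', hset]
    rcases P.eq_empty_or_nonempty with rfl | hne
    · have hpI := Ioo_subset_Icc_self hP.1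
      have hG := h.hasGaussianLaw hpI
      have hlaw := hG.map_eq_gaussianReal
      rw [h.integral_eq_zero hpI, ← covariance_self hG.aemeasurable, h.cov_eq hpI hpI,
        bridgeCov_of_le le_rfl] at hlaw
      have hrl : 0 < r - ℓ := by linarith [hP.1.1, hP.1.2]
      have hsub : B p ⁻¹' Icc 0 c ⊆ {ω | (∀ s ∈ (∅ : Finset ℝ), |B s ω| ≤ c) ∧ |B p ω| ≤ c} :=
        fun ω hω => ⟨by simp, by rw [abs_of_nonneg hω.1]; exact hω.2⟩
      refine le_trans ?_ (measure_mono hsub)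
      rw [← Measure.map_apply (h.measurable p hpI) measurableSet_Icc, hlaw, Finset.card_empty,
        pow_zero, mul_one]
      refine le_gaussianReal_Icc (le_trans (mul_le_mul_of_nonneg_left ?_ ha) hac)
      refine Real.sqrt_le_sqrt ?_
      rw [Real.coe_toNNReal', max_le_iff]
      refine ⟨?_, hrl.le⟩
      rw [div_le_iff₀ hrl]
      have := hP.1.1
      have := hP.1.2
      nlinarith
    · obtain ⟨q, hq, hqmax⟩ := P.exists_max_image id hne
      refine le_trans ?_ (h.measure_insert_ge hP.2 hq hqmax hP.1 (hmax q hq) ha hac)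
      gcongr
      exact ih hP.2

lemma measure_tube_ge (h : IsBrownianBridge ν ℓ r x y B) (hP : (P : Set ℝ) ⊆ Ioo ℓ r)
    {β : ℝ → ℝ} (hβ : ∀ p ∈ P, 0 ≤ β p) {a c : ℝ} (ha : 0 ≤ a) (hac : a * √(r - ℓ) ≤ c) :
    Real.exp (-((∑ p ∈ P, β p * potential ℓ r P β p) / 2) - c * ∑ p ∈ P, β p) *
        (gaussianReal 0 1).real (Icc 0 a) ^ P.card ≤
      ν.real {ω | ∀ p ∈ P, |B p ω - (chord ℓ r x y p + potential ℓ r P β p)| ≤ c} := by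
  have := h.gaussian.isProbabilityMeasure
  have hPI : (P : Set ℝ) ⊆ Icc ℓ r := hP.trans Ioo_subset_Icc_self
  have h0 := h.sub_chord
  have hCM := measure_cube_shift_ge (h0.hasGaussianLaw_restrict hPI)
    (fun p => h0.measurable p (hPI p.2)) (fun p => h0.integral_eq_zero (hPI p.2))
    (fun p => β p) (fun p => hβ p p.2) (c := c) fun p => h0.cov_sum hPI β (hPI p.2)
  rw [h0.var_sum hPI β, Finset.sum_coe_sort P] at hCM
  have hcube := h0.measure_cube_ge hP ha hac
  have e1 : {ω | ∀ p : P, |B p ω - chord ℓ r x y p| ≤ c} =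
      {ω | ∀ p ∈ P, |B p ω - chord ℓ r x y p| ≤ c} := by
    ext ω; simp
  have e2 : {ω | ∀ p : P, |B p ω - chord ℓ r x y p - potential ℓ r P β p| ≤ c} =
      {ω | ∀ p ∈ P, |B p ω - (chord ℓ r x y p + potential ℓ r P β p)| ≤ c} := by
    ext ω; simp [sub_sub]
  rw [e1, e2] at hCM
  have hfin := (mul_le_mul_right hcube _).trans hCM
  have := ENNReal.toReal_mono (measure_ne_top _ _) hfin
  rwa [ENNReal.toReal_mul, ENNReal.toReal_pow, ENNReal.toReal_ofReal (Real.exp_pos _).le] at this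

/-- Exponential Chebyshev bound for passing above an obstacle, tested with the slope drops `β` of
the obstacle solution. -/
lemma measure_above_le (h : IsBrownianBridge ν ℓ r x y B) (hP : (P : Set ℝ) ⊆ Ioo ℓ r)
    {g β : ℝ → ℝ} {η : ℝ} (hβ : SolvesObstacle ℓ r x y P (fun p => g p + η) β) :
    ν.real {ω | ∀ p ∈ P, g p < B p ω} ≤
      Real.exp (-((∑ p ∈ P, β p * potential ℓ r P β p) / 2) + η * ∑ p ∈ P, β p) := by
  have := h.gaussian.isProbabilityMeasure
  have hPI : (P : Set ℝ) ⊆ Icc ℓ r := hP.trans Ioo_subset_Icc_self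
  have h0 := h.sub_chord
  have hCh := measure_linear_ge_le (h0.hasGaussianLaw_restrict hPI)
    (fun p => h0.integral_eq_zero (hPI p.2)) (fun p : P => β p)
    (∑ p ∈ P, β p * potential ℓ r P β p - η * ∑ p ∈ P, β p)
  rw [h0.var_sum hPI β] at hCh
  refine (measureReal_mono fun ω hω => ?_).trans (hCh.trans (le_of_eq ?_))
  · rw [mem_ofPred_eq, Finset.sum_coe_sort P fun p => β p * (B p ω - chord ℓ r x y p),
      Finset.mul_sum, ← Finset.sum_sub_distrib]
    refine Finset.sum_le_sum fun p hp => ?_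
    have h1 := hβ.touch p hp
    have h2 := mul_le_mul_of_nonneg_left (hω p hp).le (hβ.nonneg p hp)
    linarith
  · congr 1; ring

/-- Staying within `c` of the obstacle solution for the raised obstacle `g + η` is, up to a cost
linear in `c + η` and in the total slope drop, as likely as passing above `g`: the Dirichlet
energies of the two events cancel. -/
lemma measure_tube_ge_measure_above (h : IsBrownianBridge ν ℓ r x y B)
    (hP : (P : Set ℝ) ⊆ Ioo ℓ r) {g β : ℝ → ℝ} {η : ℝ}
    (hβ : SolvesObstacle ℓ r x y P (fun p => g p + η) β) {a c : ℝ} (ha : 0 ≤ a)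
    (hac : a * √(r - ℓ) ≤ c) :
    Real.exp (-((c + η) * ∑ p ∈ P, β p)) * (gaussianReal 0 1).real (Icc 0 a) ^ P.card *
        ν.real {ω | ∀ p ∈ P, g p < B p ω} ≤
      ν.real {ω | ∀ p ∈ P, |B p ω - (chord ℓ r x y p + potential ℓ r P β p)| ≤ c} := by
  refine le_trans ?_ (h.measure_tube_ge hP hβ.nonneg ha hac)
  refine (mul_le_mul_of_nonneg_left (h.measure_above_le hP hβ) (by positivity)).trans
    (le_of_eq ?_)
  rw [mul_right_comm, ← Real.exp_add]
  congr 2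
  ring

end IsBrownianBridge

/-- Summing the gaps between consecutive entries from the last one upwards. -/
lemma add_mul_le_of_gaps {k : ℕ} {a : Fin k → ℝ} {d e : ℝ}
    (hgap : ∀ i j : Fin k, (j : ℕ) = i + 1 → d ≤ a i - a j)
    (hlast : ∀ j : Fin k, (j : ℕ) + 1 = k → e ≤ a j) (j : Fin k) :
    e + ((k : ℝ) - 1 - j) * d ≤ a j := by
  have key : ∀ (m : ℕ) (j : Fin k), (j : ℕ) + m + 1 = k → e + m * d ≤ a j := by
    intro m
    induction m with
    | zero => intro j hj; simpa using hlast j hj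
    | succ m ih =>
      intro j hj
      have h1 := ih ⟨j + 1, by omega⟩ (by simp only; omega)
      have h2 := hgap j ⟨j + 1, by omega⟩ rfl
      push_cast
      linarith
  have h := key (k - 1 - j) j (by omega)
  have hj : (j : ℕ) + (k - 1 - j) + 1 = k := by omega
  have hj' : ((k - 1 - j : ℕ) : ℝ) = (k : ℝ) - 1 - j := by
    have : ((j : ℕ) : ℝ) + ((k - 1 - j : ℕ) : ℝ) + 1 = k := by exact_mod_cast hj
    linarith
  rwa [hj'] at h

/-! ### The jump measure and independence of the curves -/

section Jump

variable {Ω : Type*} [MeasurableSpace Ω] {ν : Measure Ω} {k : ℕ}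
  {L : Fin k → ℝ → Ω → ℝ} {g : ℝ → ℝ} {P : Finset ℝ}

lemma lintegral_jumpWeight (hW : MeasurableSet {ω | ∀ p ∈ P, ∀ j, g p < L j p ω}) :
    ∫⁻ ω, jumpWeight L g P ω ∂ν = ν {ω | ∀ p ∈ P, ∀ j, g p < L j p ω} :=
  lintegral_indicator_one hW

lemma div_le_jumpMeasure_real [IsProbabilityMeasure ν]
    (hW : MeasurableSet {ω | ∀ p ∈ P, ∀ j, g p < L j p ω})
    {A H : Set Ω} (hAW : A ⊆ {ω | ∀ p ∈ P, ∀ j, g p < L j p ω}) (hAH : A ⊆ H) :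
    ν.real A / ν.real {ω | ∀ p ∈ P, ∀ j, g p < L j p ω} ≤ (jumpMeasure ν L g P).real H := by
  set W := {ω | ∀ p ∈ P, ∀ j, g p < L j p ω} with hWdef
  have hwm : Measurable (jumpWeight L g P) := measurable_one.indicator hW
  have hfin : jumpMeasure ν L g P univ ≠ ∞ := by
    rw [jumpMeasure, withDensity_apply _ MeasurableSet.univ, Measure.restrict_univ]
    simp only [div_eq_mul_inv]
    rw [lintegral_mul_const _ hwm, ← div_eq_mul_inv]
    exact (ENNReal.div_self_le_one.trans_lt ENNReal.one_lt_top).ne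
  have hle : ν A / ν W ≤ jumpMeasure ν L g P H := by
    calc ν A / ν W = ∫⁻ ω in A, jumpWeight L g P ω / ν W ∂ν := by
          simp only [div_eq_mul_inv]
          rw [lintegral_mul_const _ hwm, jumpWeight, lintegral_indicator_one hW,
            Measure.restrict_apply hW, inter_eq_self_of_subset_right hAW]
      _ ≤ jumpMeasure ν L g P A := by
          rw [jumpMeasure, lintegral_jumpWeight hW]
          exact withDensity_apply_le _ _
      _ ≤ _ := measure_mono hAH
  have := ENNReal.toReal_mono (measure_ne_top_of_subset (subset_univ H) hfin) hle
  rwa [ENNReal.toReal_div] at this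

end Jump

section Ensemble

variable {Ω : Type*} [MeasurableSpace Ω] {ν : Measure Ω} {k : ℕ}
  {ℓ r : ℝ} {aminus aplus : Fin k → ℝ} {L : Fin k → ℝ → Ω → ℝ} {P : Finset ℝ}

/-- Events described by the values of the individual curves on `P` are independent. -/
lemma IsFreeBridgeEnsemble.measureReal_forall (hL : IsFreeBridgeEnsemble ν ℓ r aminus aplus L)
    (hP : (P : Set ℝ) ⊆ Icc ℓ r) {S : Fin k → ℝ → Set ℝ} (hS : ∀ j p, MeasurableSet (S j p)) :
    MeasurableSet {ω | ∀ j, ∀ p ∈ P, L j p ω ∈ S j p} ∧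
    ν.real {ω | ∀ j, ∀ p ∈ P, L j p ω ∈ S j p} =
      ∏ j, ν.real {ω | ∀ p ∈ P, L j p ω ∈ S j p} := by
  have hcyl : ∀ j, MeasurableSet {u : Icc ℓ r → ℝ | ∀ p : P, u ⟨p, hP p.2⟩ ∈ S j p} := fun j => by
    rw [ofPred_forall]
    exact MeasurableSet.iInter fun p => measurable_pi_apply _ (hS j p)
  have hpre : ∀ j, {ω | ∀ p ∈ P, L j p ω ∈ S j p} = (fun ω (t : Icc ℓ r) => L j t ω) ⁻¹'
      {u : Icc ℓ r → ℝ | ∀ p : P, u ⟨p, hP p.2⟩ ∈ S j p} := fun j => by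
    ext ω; simp
  have hm : ∀ j, MeasurableSet {ω | ∀ p ∈ P, L j p ω ∈ S j p} := fun j => by
    rw [hpre]
    exact (measurable_pi_lambda _ fun t : Icc ℓ r => (hL.bridge j).measurable t t.2) (hcyl j)
  rw [ofPred_forall]
  refine ⟨MeasurableSet.iInter hm, ?_⟩
  have := hL.indep.meas_iInter (s := fun j => {ω | ∀ p ∈ P, L j p ω ∈ S j p})
    fun j => ⟨_, hcyl j, (hpre j).symm⟩
  rw [measureReal_def, this, ENNReal.toReal_prod]
  rfl

/-- The lower bound on the gap probability, with an explicit cost per curve. Each curve `j` follows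
the solution of the obstacle problem for `g` raised by `D + (k - 1 - j) d`, within distance `c`. -/
lemma IsFreeBridgeEnsemble.pow_le_jumpMeasure_gapEvent [IsProbabilityMeasure ν]
    (hL : IsFreeBridgeEnsemble ν ℓ r aminus aplus L) (hℓr : ℓ < r) (hP : (P : Set ℝ) ⊆ Ioo ℓ r)
    {g : ℝ → ℝ} {M : ℝ} (hM : 0 ≤ M)
    (hg : ∀ s ∈ Icc ℓ r, ∀ t ∈ Icc ℓ r, |g s - g t| ≤ M * |s - t|)
    {d D : ℝ} (hd : 0 ≤ d)
    (hgap : ∀ i j : Fin k, (j : ℕ) = i + 1 → d ≤ aminus i - aminus j ∧ d ≤ aplus i - aplus j)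
    (hlast : ∀ j : Fin k, (j : ℕ) + 1 = k → D ≤ aminus j - g ℓ ∧ D ≤ aplus j - g r)
    {a c : ℝ} (ha : 0 < a) (hac : a * √(r - ℓ) ≤ c) {d' D' : ℝ} (hD'0 : 0 < D')
    (hd' : d' + 2 * c ≤ d) (hD' : D' + c ≤ D) :
    (Real.exp (-((c + (D + k * d)) * (2 * M))) *
      (gaussianReal 0 1).real (Icc 0 a) ^ P.card) ^ k ≤
      (jumpMeasure ν L g P).real (gapEvent L g P d' D') := by
  have hPI : (P : Set ℝ) ⊆ Icc ℓ r := hP.trans Ioo_subset_Icc_self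
  have hc : 0 ≤ c := (mul_nonneg ha.le (Real.sqrt_nonneg _)).trans hac
  have hq : 0 < (gaussianReal 0 1).real (Icc 0 a) :=
    ENNReal.toReal_pos (gaussianReal_Icc_pos ha).ne' (measure_ne_top _ _)
  set h : Fin k → ℝ := fun j => D + ((k : ℝ) - 1 - j) * d with hh
  have hk : ∀ j : Fin k, 0 ≤ (k : ℝ) - 1 - j := fun j => by
    have : ((j : ℕ) : ℝ) + 1 ≤ k := by exact_mod_cast j.2
    linarith
  have hDh : ∀ j, D ≤ h j := fun j => by
    have := mul_nonneg (hk j) hd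
    simp only [hh]; linarith
  have hhD : ∀ j, h j ≤ D + k * d := fun j => by
    have : 0 ≤ ((j : ℕ) : ℝ) * d := by positivity
    simp only [hh]; linarith
  have hleft : ∀ j, g ℓ + h j ≤ aminus j := fun j => by
    have := add_mul_le_of_gaps (a := aminus) (d := d) (e := g ℓ + D) (fun i j hij => (hgap i j hij).1)
      (fun j hj => by linarith [(hlast j hj).1]) j
    simp only [hh]; linarith
  have hright : ∀ j, g r + h j ≤ aplus j := fun j => by
    have := add_mul_le_of_gaps (a := aplus) (d := d) (e := g r + D) (fun i j hij => (hgap i j hij).2)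
      (fun j hj => by linarith [(hlast j hj).2]) j
    simp only [hh]; linarith
  choose β hβ using fun j => SolvesObstacle.exists_solution hP (aminus j) (aplus j)
    (fun p => g p + h j)
  set η : Fin k → ℝ → ℝ := fun j p => chord ℓ r (aminus j) (aplus j) p + potential ℓ r P (β j) p
    with hη
  have horder : ∀ i j : Fin k, (j : ℕ) = i + 1 → ∀ p ∈ P, η j p + d ≤ η i p := by
    intro i j hij p hp
    have hg' := hgap i j hij
    refine (hβ i).add_le hℓr hP (hβ j) (by linarith) (by linarith) (fun p _ => ?_) p hp
    simp only [hh, hij]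
    push_cast
    linarith
  have hsum : ∀ j, ∑ p ∈ P, β j p ≤ 2 * M := by
    intro j
    have hl : ℓ ∈ Icc ℓ r := ⟨le_rfl, hℓr.le⟩
    have hr : r ∈ Icc ℓ r := ⟨hℓr.le, le_rfl⟩
    refine (hβ j).sum_le hℓr hP hM (fun p hp => ?_) (fun p hp => ?_)
    · have h1 := le_of_abs_le (hg p (hPI hp) ℓ hl)
      rw [abs_of_pos (sub_pos.2 (hP hp).1)] at h1
      linarith [hleft j]
    · have h1 := le_of_abs_le (hg p (hPI hp) r hr)
      rw [abs_sub_comm, abs_of_pos (sub_pos.2 (hP hp).2)] at h1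
      linarith [hright j]
  have hsum0 : ∀ j, 0 ≤ ∑ p ∈ P, β j p := fun j => Finset.sum_nonneg (hβ j).nonneg
  obtain ⟨hWm, hWprod⟩ := hL.measureReal_forall hPI (S := fun _ p => Ioi (g p))
    fun _ _ => measurableSet_Ioi
  obtain ⟨-, hTprod⟩ := hL.measureReal_forall hPI (S := fun j p => {z | |z - η j p| ≤ c})
    fun j p => measurableSet_le (by fun_prop) measurable_const
  have hWeq : {ω | ∀ j, ∀ p ∈ P, L j p ω ∈ Ioi (g p)} = {ω | ∀ p ∈ P, ∀ j, g p < L j p ω} := by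
    ext ω
    exact ⟨fun H p hp j => H j p hp, fun H j p hp => H p hp j⟩
  rw [hWeq] at hWm hWprod
  -- all curves follow their obstacle solutions; this forces both the weight and the gaps
  set T : Set Ω := {ω | ∀ j, ∀ p ∈ P, L j p ω ∈ {z | |z - η j p| ≤ c}} with hT
  have hTmem : ∀ ω ∈ T, ∀ j, ∀ p ∈ P, |L j p ω - η j p| ≤ c := fun ω hω j p hp => by
    simpa only [mem_ofPred_eq] using hω j p hp
  have hTW : T ⊆ {ω | ∀ p ∈ P, ∀ j, g p < L j p ω} := by
    intro ω hω p hp j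
    have h1 := (abs_le.1 (hTmem ω hω j p hp)).1
    have h2 := (hβ j).above p hp
    have h3 := hDh j
    simp only [hη] at h1
    linarith
  have hTH : T ⊆ gapEvent L g P d' D' := by
    intro ω hω
    refine ⟨fun p hp i j hij => ?_, fun p hp j _ => ?_⟩
    · have h1 := (abs_le.1 (hTmem ω hω i p hp)).1
      have h2 := (abs_le.1 (hTmem ω hω j p hp)).2
      have h3 := horder i j hij p hp
      linarith
    · have h1 := (abs_le.1 (hTmem ω hω j p hp)).1
      have h2 := (hβ j).above p hp
      have h3 := hDh j
      simp only [hη] at h1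
      linarith
  have hTpos : 0 < ν.real T := by
    rw [hTprod]
    exact Finset.prod_pos fun j _ => lt_of_lt_of_le (by positivity)
      ((hL.bridge j).measure_tube_ge hP (hβ j).nonneg ha.le hac)
  have hWpos := hTpos.trans_le (measureReal_mono hTW)
  refine le_trans ?_ (div_le_jumpMeasure_real hWm hTW hTH)
  rw [le_div_iff₀ hWpos, hTprod, hWprod]
  have hconst : ∀ x : ℝ, x ^ k = ∏ _j : Fin k, x := fun x => by simp
  rw [hconst, ← Finset.prod_mul_distrib]
  refine Finset.prod_le_prod (fun j _ => by positivity) fun j _ => ?_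
  refine le_trans ?_ ((hL.bridge j).measure_tube_ge_measure_above hP (hβ j) ha.le hac)
  refine mul_le_mul_of_nonneg_right (mul_le_mul_of_nonneg_right ?_ (by positivity))
    measureReal_nonneg
  rw [Real.exp_le_exp, neg_le_neg_iff]
  have h1 := hDh j
  exact mul_le_mul (by linarith [hhD j]) (hsum j) (hsum0 j) (by linarith [hhD j])

end Ensemble

/-! ### The gap estimate -/

theorem theorem5p1 (k : ℕ) (hk : 1 ≤ k) (b₀ b₁ b₂ lam₀ lam₁ μ : ℝ)
    (hb₀ : 0 < b₀) (hb₁ : 0 < b₁) (hb₂ : 0 < b₂) (hlam₀ : 0 < lam₀) (hlam₁ : 0 < lam₁)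
    (hμ₀ : 0 < μ) (hμ₁ : μ < 1) :
    ∃ C : ℝ, 0 < C ∧
      ∀ T : ℝ, 10 ≤ T →
      ∀ ℓ r : ℝ, ℓ < r → r - ℓ ≤ b₀ * T →
      ∀ P : Finset ℝ, (P : Set ℝ) ⊆ Ioo ℓ r → (P.card : ℝ) ≤ b₀ * T →
      ∀ g : ℝ → ℝ,
        (∀ x ∈ Icc ℓ r, ∀ y ∈ Icc ℓ r, |g x - g y| ≤ b₁ * T * |x - y|) →
      ∀ aminus aplus : Fin k → ℝ,
        (∀ i j : Fin k, (j : ℕ) = i + 1 →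
          lam₀ * √T ≤ aminus i - aminus j ∧ lam₀ * √T ≤ aplus i - aplus j) →
        (∀ j : Fin k, (j : ℕ) + 1 = k →
          lam₁ * T ≤ aminus j - g ℓ ∧ lam₁ * T ≤ aplus j - g r) →
        (∀ j : Fin k, (j : ℕ) = 0 →
          aminus j - g ℓ ≤ b₂ * T ^ 2 ∧ aplus j - g r ≤ b₂ * T ^ 2) →
      ∀ (Ω : Type*) [MeasurableSpace Ω] (ν : Measure Ω) [IsProbabilityMeasure ν]
        (L : Fin k → ℝ → Ω → ℝ),
        IsFreeBridgeEnsemble ν ℓ r aminus aplus L →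
        C⁻¹ * Real.exp (-C * T ^ (5 / 2 : ℝ)) ≤
          (jumpMeasure ν L g P).real (gapEvent L g P (μ * (lam₀ * √T)) (μ * (lam₁ * T))) := by
  -- the tubes have radius `δ √T`, small against both required gaps
  set δ := (1 - μ) / 2 * min lam₀ lam₁ with hδ
  have hμ' : 0 < (1 - μ) / 2 := by linarith
  have hδ0 : 0 < δ := mul_pos hμ' (lt_min hlam₀ hlam₁)
  have hδ₀ : 2 * δ ≤ (1 - μ) * lam₀ := by
    have := mul_le_mul_of_nonneg_left (min_le_left lam₀ lam₁) hμ'.le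
    linarith
  have hδ₁ : δ ≤ (1 - μ) * lam₁ := by
    have := mul_le_mul_of_nonneg_left (min_le_right lam₀ lam₁) hμ'.le
    have : 0 < (1 - μ) / 2 * lam₁ := by positivity
    linarith
  set a := δ / √b₀ with ha
  have ha0 : 0 < a := by positivity
  set q := (gaussianReal 0 1).real (Icc 0 a) with hq
  have hq0 : 0 < q := ENNReal.toReal_pos (gaussianReal_Icc_pos ha0).ne' (measure_ne_top _ _)
  have hq1 : q ≤ 1 := measureReal_le_one
  have hlog : Real.log q ≤ 0 := Real.log_nonpos hq0.le hq1
  set E := (δ + (lam₁ + k * lam₀)) * (2 * b₁) + b₀ * -Real.log q with hE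
  have hE0 : 0 ≤ E := by
    have : 0 ≤ b₀ * -Real.log q := mul_nonneg hb₀.le (by linarith)
    positivity
  -- each curve costs at most `exp (-E T²)`: `E T²` bounds the obstacle cost plus the price of the
  -- tube at the at most `b₀ T` points
  refine ⟨k * E + 1, by positivity, ?_⟩
  intro T hT ℓ r hℓr hrl P hP hcard g hg aminus aplus hgap hlast _ Ω _ ν _ L hL
  have hT1 : 1 ≤ T := by linarith
  have hT0 : 0 < T := by linarith
  have hsqrt : √T ≤ T := by
    rw [Real.sqrt_le_left hT0.le]; nlinarith
  have hs0 : 0 < √T := Real.sqrt_pos.2 hT0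
  have hac : a * √(r - ℓ) ≤ δ * √T := by
    have h1 : √(r - ℓ) ≤ √b₀ * √T := by
      rw [← Real.sqrt_mul hb₀.le]; exact Real.sqrt_le_sqrt hrl
    calc a * √(r - ℓ) ≤ a * (√b₀ * √T) := mul_le_mul_of_nonneg_left h1 ha0.le
      _ = δ * √T := by rw [ha]; field_simp
  have hmain := hL.pow_le_jumpMeasure_gapEvent (d' := μ * (lam₀ * √T)) (D' := μ * (lam₁ * T))
    hℓr hP (by positivity) hg (by positivity) hgap hlast ha0 hac (by positivity)
    (by nlinarith) (by nlinarith [mul_le_mul_of_nonneg_left hsqrt hδ0.le])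
  refine le_trans ?_ hmain
  have hone : Real.exp (-(E * T ^ 2)) ≤
      Real.exp (-((δ * √T + (lam₁ * T + k * (lam₀ * √T))) * (2 * (b₁ * T)))) * q ^ P.card := by
    have h1 : q ^ P.card = Real.exp (P.card * Real.log q) := by
      rw [Real.exp_nat_mul, Real.exp_log hq0]
    rw [h1, ← Real.exp_add, Real.exp_le_exp]
    have h2 : (P.card : ℝ) * -Real.log q ≤ b₀ * T ^ 2 * -Real.log q := by
      refine mul_le_mul_of_nonneg_right (hcard.trans ?_) (by linarith)
      refine mul_le_mul_of_nonneg_left ?_ hb₀.le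
      nlinarith
    have h3 : δ * √T + (lam₁ * T + k * (lam₀ * √T)) ≤ (δ + (lam₁ + k * lam₀)) * T := by
      have h4 := mul_le_mul_of_nonneg_left hsqrt (show 0 ≤ δ + k * lam₀ by positivity)
      linarith
    have h5 := mul_le_mul_of_nonneg_right h3 (show 0 ≤ 2 * (b₁ * T) by positivity)
    rw [hE]
    linarith
  have hpow := pow_le_pow_left₀ (Real.exp_pos _).le hone k
  refine le_trans ?_ hpow
  rw [← Real.exp_nat_mul]
  have hT52 : T ^ 2 ≤ T ^ (5 / 2 : ℝ) := by
    rw [← Real.rpow_natCast]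
    exact Real.rpow_le_rpow_of_exponent_le hT1 (by norm_num)
  have hC : (k * E + 1)⁻¹ ≤ 1 := inv_le_one_of_one_le₀ (by
    have : 0 ≤ k * E := by positivity
    linarith)
  refine (mul_le_of_le_one_left (Real.exp_pos _).le hC).trans (Real.exp_le_exp.2 ?_)
  have h6 := mul_le_mul_of_nonneg_left hT52 (show 0 ≤ (k : ℝ) * E by positivity)
  have h7 : 0 ≤ T ^ (5 / 2 : ℝ) := by positivity
  linarith
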